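/- Let $d\ge 1$, $M\ge 2$ and $\gamma>0$. Let $\kappa_A,\kappa_U:(0,4]\to\mathbb R$ be functions whose limits at $0^+$ exist and are finite, extended to $0$ by these limits, and let $K_A(x,y)=\kappa_A(\|x-y\|^2)$ and $K_U(x,y)=\kappa_U(\|x-y\|^2)$ for $x,y\in\mathbb S^{d-1}=\{u\in\mathbb R^d:\|u\|_2=1\}$. For $M$-tuples $U=(u_1,\dots,u_M)$ and $V=(v_1,\dots,v_M)$ of points of $\mathbb S^{d-1}$ let $$L(U,V)=-\frac1M\sum_{i=1}^M K_A(u_i,v_i)+\frac{\gamma}{M(M-1)}\sum_{i\ne j}K_U(u_i,u_j),\qquad L_{\mathrm{sym}}(U,V)=\tfrac12\bigl(L(U,V)+L(V,U)\bigr).$$ (a) Let $1<M\le d+1$. Then there are $M$-tuples $U$ of points of $\mathbb S^{d-1}$ that form a regular $(M-1)$-simplex centred at the origin. If $\kappa_A$ is decreasing and $\kappa_U$ is decreasing and convex, then every pair $(U,V)$ such that $U=V$ and $U$ forms a regular $(M-1)$-simplex centred at the origin is a global minimiser of $L_{\mathrm{sym}}$ over $(\mathbb S^{d-1})^M\times(\mathbb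 S^{d-1})^M$. If $\kappa_A$ is strictly decreasing and $\kappa_U$ is strictly decreasing and strictly convex, then these pairs are the only global minimisers. (b) Let $M=2d$. Then there are $M$-tuples $U$ of points of $\mathbb S^{d-1}$ that form a cross-polytope, that is, that list without repetition the points $\pm e_1,\dots,\pm e_d$ for some orthonormal basis $e_1,\dots,e_d$ of $\mathbb R^d$. If $\kappa_A$ is decreasing and $\kappa_U$ is completely monotone on $(0,4]$ (derivatives of all orders exist, one-sided at $4$, and $(-1)^n\kappa_U^{(n)}\ge 0$ for all $n\ge 0$), then every pair $(U,V)$ such that $U=V$ and $U$ forms a cross-polytope is a global minimiser of $L_{\mathrm{sym}}$ over $(\mathbb S^{d-1})^M\times(\mathbb S^{d-1})^M$. Here "decreasing" means non-increasing; monotonicity and convexity are on $(0,4]$. -/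

import Mathlib

open Set Filter Topology
open scoped ContDiff

noncomputable section

namespace KCL

/-- The unit sphere `𝕊^{d-1}` of `ℝ^d` with its Euclidean norm. -/
abbrev UnitSphere (d : ℕ) : Type := Metric.sphere (0 : EuclideanSpace ℝ (Fin d)) 1

/-- The radial kernel `K(x, y) = κ(‖x - y‖²)` on the unit sphere of a function `κ : (0, 4] → ℝ`
whose limit at `0⁺` is `l`. The values of `κ` outside `(0, 4]` play no role: squared distances
on the unit sphere are at most `4`, and at coinciding points the kernel takes the value `l`. -/
def radialKernel {d : ℕ} (κ : ℝ → ℝ) (l : ℝ) (x y : UnitSphere d) : ℝ :=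
  open Classical in if x = y then l else κ (‖(x : EuclideanSpace ℝ (Fin d)) - y‖ ^ 2)

/-- The mini-batch kernel contrastive loss of a pair of `M`-tuples of points of the sphere. -/
def kcl {d M : ℕ} (KA KU : UnitSphere d → UnitSphere d → ℝ) (γ : ℝ)
    (U V : Fin M → UnitSphere d) : ℝ :=
  -(1 / (M : ℝ)) * ∑ i, KA (U i) (V i) +
    γ * (1 / ((M : ℝ) * ((M : ℝ) - 1))) * ∑ i, ∑ j ∈ Finset.univ.erase i, KU (U i) (U j)

/-- The symmetrised loss. -/
def kclSym {d M : ℕ} (KA KU : UnitSphere d → UnitSphere d → ℝ) (γ : ℝ)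
    (U V : Fin M → UnitSphere d) : ℝ :=
  1 / 2 * (kcl KA KU γ U V + kcl KA KU γ V U)

/-- The set of global minimisers of the symmetrised loss over pairs of `M`-tuples. -/
def kclArgmin {d M : ℕ} (KA KU : UnitSphere d → UnitSphere d → ℝ) (γ : ℝ) :
    Set ((Fin M → UnitSphere d) × (Fin M → UnitSphere d)) :=
  {p | IsMinOn (fun q : (Fin M → UnitSphere d) × (Fin M → UnitSphere d) =>
    kclSym KA KU γ q.1 q.2) univ p}

/-- The points `u₁, …, u_M` of the sphere are the vertices of a regular `(M-1)`-simplex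
centred at the origin: they are affinely independent, all edges have the same length,
and the barycentre is the origin. -/
def IsCenteredRegularSimplex {d M : ℕ} (U : Fin M → UnitSphere d) : Prop :=
  AffineIndependent ℝ (fun i => (U i : EuclideanSpace ℝ (Fin d))) ∧
  (∃ r : ℝ, ∀ i j, i ≠ j →
    dist (U i : EuclideanSpace ℝ (Fin d)) (U j : EuclideanSpace ℝ (Fin d)) = r) ∧
  ∑ i, (U i : EuclideanSpace ℝ (Fin d)) = 0

/-- The points `u₁, …, u_M` are, in some order and without repetition, the vertices
`e₁, …, e_d, -e₁, …, -e_d` of the cross-polytope of an orthonormal basis `e` of `ℝ^d`. -/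
def IsCrossPolytope {d M : ℕ} (U : Fin M → UnitSphere d) : Prop :=
  ∃ (e : OrthonormalBasis (Fin d) ℝ (EuclideanSpace ℝ (Fin d))) (σ : Fin d ⊕ Fin d ≃ Fin M),
    ∀ k, (U (σ (Sum.inl k)) : EuclideanSpace ℝ (Fin d)) = e k ∧
      (U (σ (Sum.inr k)) : EuclideanSpace ℝ (Fin d)) = -e k

/-- `f` is completely monotone on `s`: it has derivatives of all orders on `s` (relative to `s`,
hence one-sided at an endpoint of an interval) and `(-1)ⁿ f⁽ⁿ⁾ ≥ 0` on `s` for all `n ≥ 0`. -/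
def CompletelyMonotoneOn (f : ℝ → ℝ) (s : Set ℝ) : Prop :=
  ContDiffOn ℝ ∞ f s ∧ ∀ (n : ℕ), ∀ x ∈ s, 0 ≤ (-1) ^ n * iteratedDerivWithin n f s x

end KCL

end

/-!
An alignment kernel that is maximal on the diagonal makes the alignment term as small as possible
exactly when `U = V`, so everything reduces to minimising the pair energy
`∑_{i ≠ j} κ_U (‖u_i - u_j‖²)`, where `κ_U` is extended to `0` by its limit as
`Function.update κ_U 0 l_U`.

For unit vectors `∑_{i ≠ j} ‖u_i - u_j‖² = 2 M² - 2 ‖∑ u_i‖²`, so the mean squared distance is at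
most that of the centred regular simplex, and Jensen's inequality with monotonicity bounds the
energy below by that of the simplex; strictness forces all distances to be equal.

The cross-polytope has only the squared distances `2` and `4`. The quadratic that interpolates
`κ_U` twice at `2` and once at `4` lies below `κ_U`, because the derivative of the difference is
concave. The energy of a quadratic depends only on `‖∑ u_i‖²` and on the frame potential
`∑ ⟪u_i, u_j⟫² ≥ M² / d`, both of which are minimised by the cross-polytope.
-/

namespace KCL

section EndpointExtension

variable {κ : ℝ → ℝ} {a b l : ℝ}

lemma antitoneOn_update_Icc (hκ : AntitoneOn κ (Ioc a b)) (hl : Tendsto κ (𝓝[>] a) (𝓝 l)) :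
    AntitoneOn (Function.update κ a l) (Icc a b) := by
  intro x hx y hy hxy
  rcases hxy.eq_or_lt with rfl | hxy
  · rfl
  have hay : a < y := hx.1.trans_lt hxy
  rcases hx.1.eq_or_lt with rfl | hax
  · rw [Function.update_self, Function.update_of_ne hay.ne']
    refine ge_of_tendsto hl ?_
    filter_upwards [Ioo_mem_nhdsGT hay] with z hz
    exact hκ ⟨hz.1, hz.2.le.trans hy.2⟩ ⟨hay, hy.2⟩ hz.2.le
  · rw [Function.update_of_ne hax.ne', Function.update_of_ne hay.ne']
    exact hκ ⟨hax, hx.2⟩ ⟨hay, hy.2⟩ hxy.le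

lemma strictAntiOn_update_Icc (hκ : StrictAntiOn κ (Ioc a b))
    (hl : Tendsto κ (𝓝[>] a) (𝓝 l)) : StrictAntiOn (Function.update κ a l) (Icc a b) := by
  intro x hx y hy hxy
  obtain ⟨z, hxz, hzy⟩ := exists_between hxy
  have haz : a < z := hx.1.trans_lt hxz
  have hzb : z ≤ b := hzy.le.trans hy.2
  refine lt_of_lt_of_le ?_ (antitoneOn_update_Icc hκ.antitoneOn hl hx ⟨haz.le, hzb⟩ hxz.le)
  rw [Function.update_of_ne haz.ne', Function.update_of_ne (haz.trans hzy).ne']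
  exact hκ ⟨haz, hzb⟩ ⟨haz.trans hzy, hy.2⟩ hzy

lemma continuousOn_update_Icc (hκ : ContinuousOn κ (Ioc a b))
    (hl : Tendsto κ (𝓝[>] a) (𝓝 l)) : ContinuousOn (Function.update κ a l) (Icc a b) := by
  rw [continuousOn_update_iff, Icc_sdiff_left]
  exact ⟨hκ, fun _ => hl.mono_left (nhdsWithin_mono _ Ioc_subset_Ioi_self)⟩

lemma secant_limit_le_secant (hκ : ConvexOn ℝ (Ioc a b) κ) (hl : Tendsto κ (𝓝[>] a) (𝓝 l))
    {z y : ℝ} (haz : a < z) (hzy : z < y) (hyb : y ≤ b) :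
    (κ y - l) / (y - a) ≤ (κ y - κ z) / (y - z) := by
  have hlim : Tendsto (fun x => (κ y - κ x) / (y - x)) (𝓝[>] a) (𝓝 ((κ y - l) / (y - a))) :=
    (tendsto_const_nhds.sub hl).div
      ((tendsto_const_nhds.sub tendsto_id).mono_left nhdsWithin_le_nhds)
      (sub_ne_zero.2 (haz.trans hzy).ne')
  refine le_of_tendsto hlim ?_
  filter_upwards [Ioo_mem_nhdsGT haz] with x hx
  have h := hκ.secant_mono ⟨haz.trans hzy, hyb⟩ ⟨hx.1, by linarith [hx.2]⟩ ⟨haz, by linarith⟩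
    (hx.2.trans hzy).ne hzy.ne hx.2.le
  rwa [← neg_sub (κ y), ← neg_sub y, ← neg_sub (κ y), ← neg_sub y, neg_div_neg_eq,
    neg_div_neg_eq] at h

lemma convexOn_update_Icc (hκ : ConvexOn ℝ (Ioc a b) κ) (hl : Tendsto κ (𝓝[>] a) (𝓝 l)) :
    ConvexOn ℝ (Icc a b) (Function.update κ a l) := by
  refine convexOn_of_slope_mono_adjacent (convex_Icc a b) fun {x y z} hx hz hxy hyz => ?_
  have hay : a < y := hx.1.trans_lt hxy
  rw [Function.update_of_ne hay.ne', Function.update_of_ne (hay.trans hyz).ne']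
  rcases hx.1.eq_or_lt with rfl | hax
  · obtain ⟨w, haw, hwy⟩ := exists_between hay
    rw [Function.update_self]
    exact (secant_limit_le_secant hκ hl haw hwy (hyz.le.trans hz.2)).trans
      (hκ.slope_mono_adjacent ⟨haw, by linarith [hz.2]⟩ ⟨hay.trans hyz, hz.2⟩ hwy hyz)
  · rw [Function.update_of_ne hax.ne']
    exact hκ.slope_mono_adjacent ⟨hax, hx.2⟩ ⟨hay.trans hyz, hz.2⟩ hxy hyz

lemma strictConvexOn_update_Icc (hκ : StrictConvexOn ℝ (Ioc a b) κ)
    (hl : Tendsto κ (𝓝[>] a) (𝓝 l)) :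
    StrictConvexOn ℝ (Icc a b) (Function.update κ a l) := by
  refine strictConvexOn_of_slope_strict_mono_adjacent (convex_Icc a b)
    fun {x y z} hx hz hxy hyz => ?_
  have hay : a < y := hx.1.trans_lt hxy
  rw [Function.update_of_ne hay.ne', Function.update_of_ne (hay.trans hyz).ne']
  rcases hx.1.eq_or_lt with rfl | hax
  · obtain ⟨w, haw, hwy⟩ := exists_between hay
    rw [Function.update_self]
    exact (secant_limit_le_secant hκ.convexOn hl haw hwy (hyz.le.trans hz.2)).trans_lt
      (hκ.slope_strict_mono_adjacent ⟨haw, by linarith [hz.2]⟩ ⟨hay.trans hyz, hz.2⟩ hwy hyz)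
  · rw [Function.update_of_ne hax.ne']
    exact hκ.slope_strict_mono_adjacent ⟨hax, hx.2⟩ ⟨hay.trans hyz, hz.2⟩ hxy hyz

end EndpointExtension

section HermiteInterpolation

variable {f : ℝ → ℝ} {a m b : ℝ}

-- By Rolle `deriv f` vanishes at `m` and at some `ξ ∈ (m, b)`; being concave, it is nonnegative
-- between these two zeros and nonpositive outside, so `f` falls, rises and falls.
lemma nonneg_of_concaveOn_deriv (ham : a < m) (hmb : m < b) (hf : ContinuousOn f (Icc a b))
    (hd : DifferentiableOn ℝ f (Ioo a b)) (hconc : ConcaveOn ℝ (Ioo a b) (deriv f))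
    (hm : f m = 0) (hm' : deriv f m = 0) (hb : f b = 0) {t : ℝ} (ht : t ∈ Icc a b) :
    0 ≤ f t := by
  obtain ⟨ξ, ⟨hmξ, hξb⟩, hξ⟩ :=
    exists_deriv_eq_zero hmb (hf.mono (Icc_subset_Icc_left ham.le)) (hm.trans hb.symm)
  have hmem : m ∈ Ioo a b := ⟨ham, hmb⟩
  have hξmem : ξ ∈ Ioo a b := ⟨ham.trans hmξ, hξb⟩
  have hanti : AntitoneOn f (Icc a m) := by
    refine antitoneOn_of_deriv_nonpos (convex_Icc a m) (hf.mono (Icc_subset_Icc_right hmb.le)) ?_ ?_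
      <;> rw [interior_Icc]
    · exact hd.mono (Ioo_subset_Ioo_right hmb.le)
    · intro x hx
      exact hm' ▸ hconc.left_le_of_le_right'' ⟨hx.1, hx.2.trans hmb⟩ hξmem hx.2.le hmξ
        (hm'.trans hξ.symm).le
  have hmono : MonotoneOn f (Icc m ξ) := by
    refine monotoneOn_of_deriv_nonneg (convex_Icc m ξ)
      (hf.mono (Icc_subset_Icc ham.le hξb.le)) ?_ ?_ <;> rw [interior_Icc]
    · exact hd.mono (Ioo_subset_Ioo ham.le hξb.le)
    · intro x hx
      simpa only [hm', hξ, min_self] using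
        hconc.min_le_of_mem_Icc hmem hξmem (Ioo_subset_Icc_self hx)
  have hanti' : AntitoneOn f (Icc ξ b) := by
    refine antitoneOn_of_deriv_nonpos (convex_Icc ξ b) (hf.mono (Icc_subset_Icc_left hξmem.1.le))
      ?_ ?_ <;> rw [interior_Icc]
    · exact hd.mono (Ioo_subset_Ioo_left hξmem.1.le)
    · intro x hx
      exact hξ ▸ hconc.right_le_of_le_left'' hmem ⟨hξmem.1.trans hx.1, hx.2⟩ hmξ hx.1.le
        (hξ.trans hm'.symm).le
  rcases le_total t m with htm | hmt
  · exact hm ▸ hanti ⟨ht.1, htm⟩ ⟨ham.le, le_rfl⟩ htm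
  rcases le_total t ξ with htξ | hξt
  · exact hm ▸ hmono ⟨le_rfl, hmξ.le⟩ ⟨hmt, htξ⟩ hmt
  · exact hb ▸ hanti' ⟨hξt, ht.2⟩ ⟨hξb.le, le_rfl⟩ ht.2

lemma exists_quadratic_minorant (ham : a < m) (hmb : m < b) (hf : ContinuousOn f (Icc a b))
    (hanti : AntitoneOn f (Icc a b)) (hconv : ConvexOn ℝ (Icc a b) f)
    (hd : DifferentiableOn ℝ f (Ioo a b)) (hconc : ConcaveOn ℝ (Ioo a b) (deriv f)) :
    ∃ p ≤ 0, ∃ c ≥ 0, f m + p * (b - m) + c * (b - m) ^ 2 = f b ∧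
      ∀ t ∈ Icc a b, f m + p * (t - m) + c * (t - m) ^ 2 ≤ f t := by
  have hbm : 0 < b - m := sub_pos.2 hmb
  have hmem : m ∈ Icc a b := ⟨ham.le, hmb.le⟩
  have hmem' : b ∈ Icc a b := ⟨(ham.trans hmb).le, le_rfl⟩
  have hdm : ∀ x ∈ Ioo a b, DifferentiableAt ℝ f x := fun x hx =>
    hd.differentiableAt (isOpen_Ioo.mem_nhds hx)
  have htangent : deriv f m ≤ (f b - f m) / (b - m) := by
    simpa only [slope_def_field] using hconv.deriv_le_slope hmem hmem' hmb (hdm m ⟨ham, hmb⟩)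
  obtain ⟨c, hc⟩ : ∃ c, c = ((f b - f m) / (b - m) - deriv f m) / (b - m) := ⟨_, rfl⟩
  have hinterp : f m + deriv f m * (b - m) + c * (b - m) ^ 2 = f b := by
    rw [hc]
    field_simp
    ring
  have hderiv : ∀ x, HasDerivAt (fun t => f m + deriv f m * (t - m) + c * (t - m) ^ 2)
      (deriv f m + c * (2 * (x - m))) x := fun x => by
    have h : HasDerivAt (fun t => t - m) 1 x := (hasDerivAt_id x).sub_const m
    exact (((h.const_mul _).const_add _).add ((h.pow 2).const_mul c)).congr_deriv (by ring)
  refine ⟨deriv f m, ?_, c, hc ▸ div_nonneg (sub_nonneg.2 htangent) hbm.le, hinterp,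
    fun t ht => ?_⟩
  · exact htangent.trans
      (div_nonpos_of_nonpos_of_nonneg (sub_nonpos.2 (hanti hmem hmem' hmb.le)) hbm.le)
  have hderiv' : ∀ x ∈ Ioo a b,
      deriv (fun t => f t - (f m + deriv f m * (t - m) + c * (t - m) ^ 2)) x =
        deriv f x - (deriv f m + c * (2 * (x - m))) := fun x hx =>
    ((hdm x hx).hasDerivAt.sub (hderiv x)).deriv
  refine sub_nonneg.1 (nonneg_of_concaveOn_deriv
    (f := fun t => f t - (f m + deriv f m * (t - m) + c * (t - m) ^ 2)) ham hmb
    (hf.sub (by fun_prop)) (hd.sub (by fun_prop)) ?_ (by simp)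
    (by rw [hderiv' m ⟨ham, hmb⟩]; simp) (sub_eq_zero.2 hinterp.symm) ht)
  have haffine : ConvexOn ℝ (Ioo a b) fun x => deriv f m + c * (2 * (x - m)) := by
    refine ⟨convex_Ioo a b, fun x _ y _ s t _ _ hst => le_of_eq ?_⟩
    obtain rfl : t = 1 - s := by linarith
    simp only [smul_eq_mul]
    ring
  exact (hconc.sub haffine).congr fun x hx => (hderiv' x hx).symm

end HermiteInterpolation

section PairSums

variable {ι X : Type*} [Fintype ι]

/-- The sum of a kernel `K` over all ordered pairs of distinct indices of a family of points. -/
def pairSum (K : X → X → ℝ) (u : ι → X) : ℝ :=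
  ∑ p ∈ Finset.univ.offDiag, K (u p.1) (u p.2)

/-- The potential energy of a finite family of points whose pairwise interaction `φ` is a function
of the squared distance, every unordered pair being counted twice. -/
def energy {E : Type*} [NormedAddCommGroup E] (φ : ℝ → ℝ) (u : ι → E) : ℝ :=
  pairSum (fun x y => φ (‖x - y‖ ^ 2)) u

lemma energy_mono {E : Type*} [NormedAddCommGroup E] {φ ψ : ℝ → ℝ} {u : ι → E}
    (h : ∀ i j, i ≠ j → φ (‖u i - u j‖ ^ 2) ≤ ψ (‖u i - u j‖ ^ 2)) : energy φ u ≤ energy ψ u :=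
  Finset.sum_le_sum fun _ hp => h _ _ (Finset.mem_offDiag.1 hp).2.2

lemma pairSum_add_sum_diag (K : X → X → ℝ) (u : ι → X) :
    pairSum K u + ∑ i, K (u i) (u i) = ∑ i, ∑ j, K (u i) (u j) := by
  classical
  rw [pairSum, ← Finset.sum_diag Finset.univ fun p : ι × ι => K (u p.1) (u p.2), add_comm,
    ← Finset.sum_union (Finset.disjoint_diag_offDiag _), Finset.diag_union_offDiag,
    Finset.sum_product]

lemma sum_sum_erase_eq_pairSum [DecidableEq ι] (K : X → X → ℝ) (u : ι → X) :
    ∑ i, ∑ j ∈ Finset.univ.erase i, K (u i) (u j) = pairSum K u := by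
  rw [← add_left_inj (∑ i, K (u i) (u i)), pairSum_add_sum_diag, ← Finset.sum_add_distrib]
  exact Finset.sum_congr rfl fun i _ => Finset.sum_erase_add _ _ (Finset.mem_univ i)

lemma cast_card_offDiag_univ :
    ((Finset.univ : Finset ι).offDiag.card : ℝ) = Fintype.card ι * (Fintype.card ι - 1) := by
  rw [Finset.offDiag_card, Finset.card_univ, ← Nat.mul_sub_one, Nat.cast_mul]
  rcases Nat.eq_zero_or_pos (Fintype.card ι) with h | h
  · simp only [h, Nat.cast_zero, zero_mul]
  · rw [Nat.cast_pred h]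

end PairSums

section UnitVectors

open scoped InnerProductSpace

variable {ι E : Type*} [Fintype ι] [NormedAddCommGroup E]

lemma norm_sub_sq_mem_Icc {x y : E} (hx : ‖x‖ = 1) (hy : ‖y‖ = 1) :
    ‖x - y‖ ^ 2 ∈ Icc (0 : ℝ) 4 := by
  have h : ‖x - y‖ ≤ 2 := (norm_sub_le x y).trans (by rw [hx, hy]; norm_num)
  exact ⟨sq_nonneg _, by nlinarith [norm_nonneg (x - y)]⟩

variable [InnerProductSpace ℝ E]

lemma norm_sub_sq_of_norm_eq_one {x y : E} (hx : ‖x‖ = 1) (hy : ‖y‖ = 1) :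
    ‖x - y‖ ^ 2 = 2 - 2 * ⟪x, y⟫_ℝ := by
  rw [norm_sub_sq_real, hx, hy]
  ring

/-- The frame potential of Benedetto and Fickus: the sum of the squared entries of the Gram
matrix. -/
def framePotential (u : ι → E) : ℝ :=
  ∑ i, ∑ j, ⟪u i, u j⟫_ℝ ^ 2

variable {u : ι → E}

lemma energy_quadratic (hu : ∀ i, ‖u i‖ = 1) (b a c : ℝ) :
    energy (fun t => b + a * (t - 2) + c * (t - 2) ^ 2) u =
      Fintype.card ι * (Fintype.card ι - 1) * b - 2 * a * (‖∑ i, u i‖ ^ 2 - Fintype.card ι) +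
        4 * c * (framePotential u - Fintype.card ι) := by
  let q : ℝ → ℝ := fun t => b + a * (t - 2) + c * (t - 2) ^ 2
  have hpair : ∀ i j, q (‖u i - u j‖ ^ 2) =
      b - 2 * a * ⟪u i, u j⟫_ℝ + 4 * c * ⟪u i, u j⟫_ℝ ^ 2 := fun i j => by
    simp only [q, norm_sub_sq_of_norm_eq_one (hu i) (hu j)]
    ring
  have hself : ∀ i, ⟪u i, u i⟫_ℝ = 1 := fun i => inner_self_eq_one_of_norm_eq_one (hu i)
  have hsum := pairSum_add_sum_diag (fun x y : E => q (‖x - y‖ ^ 2)) u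
  simp only [hpair, hself, Finset.sum_add_distrib, Finset.sum_sub_distrib, ← Finset.mul_sum,
    Finset.sum_const, Finset.card_univ, nsmul_eq_mul, ← inner_sum, ← sum_inner,
    real_inner_self_eq_norm_sq] at hsum
  rw [energy, framePotential]
  linear_combination hsum

lemma sum_offDiag_norm_sub_sq (hu : ∀ i, ‖u i‖ = 1) :
    ∑ p ∈ Finset.univ.offDiag, ‖u p.1 - u p.2‖ ^ 2 =
      2 * Fintype.card ι ^ 2 - 2 * ‖∑ i, u i‖ ^ 2 := by
  have h := energy_quadratic hu 2 1 0
  simp only [energy, pairSum, one_mul, add_sub_cancel, zero_mul, add_zero] at h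
  rw [h]
  ring

end UnitVectors

section FramePotential

open scoped InnerProductSpace Matrix

lemma sq_trace_mul_transpose_le {m n : Type*} [Fintype m] [Fintype n] (A : Matrix m n ℝ) :
    (A * Aᵀ).trace ^ 2 ≤ Fintype.card n * ∑ i, ∑ j, (A * Aᵀ) i j ^ 2 := by
  have hfrobenius : ∑ i, ∑ j, (A * Aᵀ) i j ^ 2 = ∑ k, ∑ l, (Aᵀ * A) k l ^ 2 := by
    have htrace : ((A * Aᵀ) * (A * Aᵀ)ᵀ).trace = ((Aᵀ * A) * (Aᵀ * A)ᵀ).trace := by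
      rw [Matrix.transpose_mul, Matrix.transpose_mul, Matrix.transpose_transpose,
        Matrix.mul_assoc, Matrix.trace_mul_comm, Matrix.mul_assoc, Matrix.mul_assoc,
        Matrix.mul_assoc]
    rw [← Matrix.sum_hadamard_eq, ← Matrix.sum_hadamard_eq] at htrace
    simpa only [Matrix.hadamard_apply, ← sq] using htrace
  calc (A * Aᵀ).trace ^ 2 = (∑ k, (Aᵀ * A) k k) ^ 2 := by rw [Matrix.trace_mul_comm]; rfl
    _ ≤ Fintype.card n * ∑ k, (Aᵀ * A) k k ^ 2 := sq_sum_le_card_mul_sum_sq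
    _ ≤ Fintype.card n * ∑ i, ∑ j, (A * Aᵀ) i j ^ 2 := by
      rw [hfrobenius]
      gcongr with k
      exact Finset.single_le_sum (f := fun l => (Aᵀ * A) k l ^ 2) (fun l _ => sq_nonneg _)
        (Finset.mem_univ k)

lemma sq_sum_norm_sq_le_finrank_mul_framePotential {ι E : Type*} [Fintype ι]
    [NormedAddCommGroup E] [InnerProductSpace ℝ E] [FiniteDimensional ℝ E] (u : ι → E) :
    (∑ i, ‖u i‖ ^ 2) ^ 2 ≤ Module.finrank ℝ E * framePotential u := by
  let b := stdOrthonormalBasis ℝ E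
  let A : Matrix ι (Fin (Module.finrank ℝ E)) ℝ := Matrix.of fun i k => ⟪u i, b k⟫_ℝ
  have hA : ∀ i j, (A * Aᵀ) i j = ⟪u i, u j⟫_ℝ := fun i j => by
    simp only [A, Matrix.mul_apply, Matrix.transpose_apply, Matrix.of_apply,
      ← b.sum_inner_mul_inner (u i) (u j), real_inner_comm (b _) (u j)]
  simpa only [Matrix.trace, Matrix.diag_apply, hA, real_inner_self_eq_norm_sq, Fintype.card_fin,
    framePotential] using sq_trace_mul_transpose_le A

end FramePotential

section Simplex

/-- The squared edge length of a regular simplex with `n` vertices inscribed in the unit sphere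
about the origin. -/
noncomputable def simplexSqDist (n : ℕ) : ℝ := 2 * n / (n - 1)

lemma simplexSqDist_mem_Ioc {n : ℕ} (hn : 1 < n) : simplexSqDist n ∈ Ioc (0 : ℝ) 4 := by
  have hn2 : (2 : ℝ) ≤ n := by exact_mod_cast hn
  have hn1 : 0 < (n : ℝ) - 1 := by linarith
  refine ⟨div_pos (by linarith) hn1, ?_⟩
  rw [simplexSqDist, div_le_iff₀ hn1]
  linarith

lemma card_mul_simplexSqDist {n : ℕ} (hn : 1 < n) :
    (n * (n - 1) : ℝ) * simplexSqDist n = 2 * n ^ 2 := by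
  have hn1 : ((n : ℝ) - 1) ≠ 0 := (sub_pos.2 (Nat.one_lt_cast.2 hn)).ne'
  rw [simplexSqDist]
  field_simp

lemma cast_mul_pred_pos {n : ℕ} (hn : 1 < n) : (0 : ℝ) < n * (n - 1) :=
  mul_pos (Nat.cast_pos.2 (zero_lt_one.trans hn)) (sub_pos.2 (Nat.one_lt_cast.2 hn))

variable {ι E : Type*} [Fintype ι]

/-- The average of the squared distances between the members of a finite family of points. -/
noncomputable def meanSqDist [NormedAddCommGroup E] (u : ι → E) : ℝ :=
  ∑ p ∈ Finset.univ.offDiag,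
    (Fintype.card ι * (Fintype.card ι - 1) : ℝ)⁻¹ • ‖u p.1 - u p.2‖ ^ 2

lemma sum_offDiag_inv_card (hι : 1 < Fintype.card ι) :
    ∑ _p ∈ (Finset.univ : Finset ι).offDiag,
      (Fintype.card ι * (Fintype.card ι - 1) : ℝ)⁻¹ = 1 := by
  rw [Finset.sum_const, nsmul_eq_mul, cast_card_offDiag_univ,
    mul_inv_cancel₀ (cast_mul_pred_pos hι).ne']

lemma energy_eq_of_sqDist_eq [NormedAddCommGroup E] {u : ι → E} {r : ℝ}
    (h : ∀ i j, i ≠ j → ‖u i - u j‖ ^ 2 = r) (φ : ℝ → ℝ) :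
    energy φ u = Fintype.card ι * (Fintype.card ι - 1) * φ r := by
  rw [energy, pairSum, ← cast_card_offDiag_univ, ← nsmul_eq_mul, ← Finset.sum_const]
  exact Finset.sum_congr rfl fun p hp => by rw [h _ _ (Finset.mem_offDiag.1 hp).2.2]

variable [NormedAddCommGroup E] {u : ι → E} {φ : ℝ → ℝ}

lemma meanSqDist_mem_Icc (hι : 1 < Fintype.card ι) (hu : ∀ i, ‖u i‖ = 1) :
    meanSqDist u ∈ Icc (0 : ℝ) 4 :=
  (convex_Icc 0 4).sum_mem (fun _ _ => (inv_pos.2 (cast_mul_pred_pos hι)).le)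
    (sum_offDiag_inv_card hι) fun _ _ => norm_sub_sq_mem_Icc (hu _) (hu _)

lemma energy_eq_card_mul_sum (hι : 1 < Fintype.card ι) (φ : ℝ → ℝ) (u : ι → E) :
    energy φ u = Fintype.card ι * (Fintype.card ι - 1) * ∑ p ∈ Finset.univ.offDiag,
      (Fintype.card ι * (Fintype.card ι - 1) : ℝ)⁻¹ • φ (‖u p.1 - u p.2‖ ^ 2) := by
  rw [← Finset.smul_sum, smul_eq_mul, mul_inv_cancel_left₀ (cast_mul_pred_pos hι).ne', energy,
    pairSum]

lemma map_meanSqDist_le_energy (hι : 1 < Fintype.card ι) (hu : ∀ i, ‖u i‖ = 1)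
    (hφ : ConvexOn ℝ (Icc 0 4) φ) :
    Fintype.card ι * (Fintype.card ι - 1) * φ (meanSqDist u) ≤ energy φ u := by
  rw [energy_eq_card_mul_sum hι]
  exact mul_le_mul_of_nonneg_left
    (hφ.map_sum_le (fun _ _ => (inv_pos.2 (cast_mul_pred_pos hι)).le) (sum_offDiag_inv_card hι)
      fun _ _ => norm_sub_sq_mem_Icc (hu _) (hu _)) (cast_mul_pred_pos hι).le

lemma sqDist_eq_meanSqDist (hι : 1 < Fintype.card ι) (hu : ∀ i, ‖u i‖ = 1)
    (hφ : StrictConvexOn ℝ (Icc 0 4) φ)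
    (h : energy φ u ≤ Fintype.card ι * (Fintype.card ι - 1) * φ (meanSqDist u)) {i j : ι}
    (hij : i ≠ j) : ‖u i - u j‖ ^ 2 = meanSqDist u := by
  have hjensen := le_antisymm (map_meanSqDist_le_energy hι hu hφ.convexOn) h
  rw [energy_eq_card_mul_sum hι, mul_right_inj' (cast_mul_pred_pos hι).ne', meanSqDist,
    hφ.map_sum_eq_iff (fun _ _ => inv_pos.2 (cast_mul_pred_pos hι)) (sum_offDiag_inv_card hι)
      fun _ _ => norm_sub_sq_mem_Icc (hu _) (hu _)] at hjensen
  exact hjensen (i, j) (by simpa using hij)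

variable [InnerProductSpace ℝ E]

lemma meanSqDist_le_simplexSqDist (hι : 1 < Fintype.card ι) (hu : ∀ i, ‖u i‖ = 1) :
    meanSqDist u ≤ simplexSqDist (Fintype.card ι) := by
  rw [meanSqDist, ← Finset.smul_sum, smul_eq_mul, inv_mul_le_iff₀ (cast_mul_pred_pos hι),
    card_mul_simplexSqDist hι, sum_offDiag_norm_sub_sq hu]
  exact sub_le_self _ (by positivity)

lemma simplex_energy_le_energy (hι : 1 < Fintype.card ι) (hu : ∀ i, ‖u i‖ = 1)
    (hanti : AntitoneOn φ (Icc 0 4)) (hconv : ConvexOn ℝ (Icc 0 4) φ) :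
    Fintype.card ι * (Fintype.card ι - 1) * φ (simplexSqDist (Fintype.card ι)) ≤ energy φ u :=
  calc Fintype.card ι * (Fintype.card ι - 1) * φ (simplexSqDist (Fintype.card ι))
    _ ≤ Fintype.card ι * (Fintype.card ι - 1) * φ (meanSqDist u) :=
      mul_le_mul_of_nonneg_left (hanti (meanSqDist_mem_Icc hι hu)
        (Ioc_subset_Icc_self (simplexSqDist_mem_Ioc hι)) (meanSqDist_le_simplexSqDist hι hu))
        (cast_mul_pred_pos hι).le
    _ ≤ energy φ u := map_meanSqDist_le_energy hι hu hconv

lemma sqDist_eq_of_energy_le_simplex_energy (hι : 1 < Fintype.card ι) (hu : ∀ i, ‖u i‖ = 1)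
    (hanti : StrictAntiOn φ (Icc 0 4)) (hconv : StrictConvexOn ℝ (Icc 0 4) φ)
    (h : energy φ u ≤
      Fintype.card ι * (Fintype.card ι - 1) * φ (simplexSqDist (Fintype.card ι)))
    {i j : ι} (hij : i ≠ j) : ‖u i - u j‖ ^ 2 = simplexSqDist (Fintype.card ι) := by
  have hsimplex : simplexSqDist (Fintype.card ι) ∈ Icc (0 : ℝ) 4 :=
    Ioc_subset_Icc_self (simplexSqDist_mem_Ioc hι)
  have hle : φ (meanSqDist u) ≤ φ (simplexSqDist (Fintype.card ι)) :=
    le_of_mul_le_mul_left ((map_meanSqDist_le_energy hι hu hconv.convexOn).trans h)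
      (cast_mul_pred_pos hι)
  have hmean : meanSqDist u = simplexSqDist (Fintype.card ι) :=
    (meanSqDist_le_simplexSqDist hι hu).antisymm
      ((hanti.le_iff_ge (meanSqDist_mem_Icc hι hu) hsimplex).1 hle)
  rw [← hmean] at h ⊢
  exact sqDist_eq_meanSqDist hι hu hconv h hij

lemma sum_eq_zero_iff_sqDist_eq (hι : 1 < Fintype.card ι) (hu : ∀ i, ‖u i‖ = 1) {r : ℝ}
    (h : ∀ i j, i ≠ j → ‖u i - u j‖ ^ 2 = r) :
    ∑ i, u i = 0 ↔ r = simplexSqDist (Fintype.card ι) := by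
  have hsum := energy_eq_of_sqDist_eq h id
  rw [energy, pairSum] at hsum
  simp only [id_eq, sum_offDiag_norm_sub_sq hu] at hsum
  rw [← mul_right_inj' (cast_mul_pred_pos hι).ne', card_mul_simplexSqDist hι, ← hsum,
    sub_eq_self, mul_eq_zero_iff_left two_ne_zero, sq_eq_zero_iff, norm_eq_zero]

lemma affineIndependent_of_sqDist_eq {κ : Type*} {v : κ → E} {r : ℝ} (hr : r ≠ 0)
    (h : ∀ i j, i ≠ j → ‖v i - v j‖ ^ 2 = r) : AffineIndependent ℝ v := by
  classical
  intro s w hw hv i hi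
  have hinner := EuclideanGeometry.inner_weightedVSub v hw v hw
  have hdist : ∀ a b, dist (v a) (v b) * dist (v a) (v b) = r - if a = b then r else 0 :=
    fun a b => by
      split_ifs with hab
      · simp [hab]
      · rw [sub_zero, dist_eq_norm, ← sq, h a b hab]
  have hsum : ∑ a ∈ s, w a ^ 2 = 0 := by
    simp only [hv, inner_zero_left, hdist, mul_sub, Finset.sum_sub_distrib, ← Finset.sum_mul,
      ← Finset.mul_sum, hw, mul_ite, mul_zero, Finset.sum_const_zero, Finset.sum_ite_eq,
      Finset.sum_ite_mem, Finset.inter_self, ← sq] at hinner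
    exact (mul_eq_zero_iff_right hr).1 (by linarith)
  exact pow_eq_zero_iff two_ne_zero |>.1
    ((Finset.sum_eq_zero_iff_of_nonneg fun _ _ => sq_nonneg _).1 hsum i hi)

lemma exists_linearIsometry_of_finrank_le {E F : Type*} [NormedAddCommGroup E]
    [InnerProductSpace ℝ E] [FiniteDimensional ℝ E] [NormedAddCommGroup F] [InnerProductSpace ℝ F]
    [FiniteDimensional ℝ F] (h : Module.finrank ℝ E ≤ Module.finrank ℝ F) :
    Nonempty (E →ₗᵢ[ℝ] F) := by
  let b := stdOrthonormalBasis ℝ E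
  have hv : Orthonormal ℝ (stdOrthonormalBasis ℝ F ∘ Fin.castLE h) :=
    (stdOrthonormalBasis ℝ F).orthonormal.comp _ (Fin.castLE_injective h)
  refine ⟨(b.toBasis.constr ℝ (stdOrthonormalBasis ℝ F ∘ Fin.castLE h)).isometryOfOrthonormal
    (v := b.toBasis) (b.coe_toBasis ▸ b.orthonormal) ?_⟩
  convert hv
  exact funext (b.toBasis.constr_basis ℝ _)

-- The vertices are the normalised orthogonal projections of the standard basis vectors.
lemma exists_simplex_orthogonal_one {n : ℕ} (hn : 1 < n) :
    ∃ u : Fin n → (ℝ ∙ (WithLp.toLp 2 1 : EuclideanSpace ℝ (Fin n)))ᗮ,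
      (∀ i, ‖u i‖ = 1) ∧ ∀ i j, i ≠ j → ‖u i - u j‖ ^ 2 = simplexSqDist n := by
  have hn0 : (0 : ℝ) < n := Nat.cast_pos.2 (zero_lt_one.trans hn)
  have hn1 : (0 : ℝ) < n - 1 := sub_pos.2 (Nat.one_lt_cast.2 hn)
  let o : EuclideanSpace ℝ (Fin n) := WithLp.toLp 2 1
  let e : Fin n → EuclideanSpace ℝ (Fin n) := fun i => EuclideanSpace.single i 1
  have hoo : inner ℝ o o = n := by simp [o, EuclideanSpace.norm_sq_eq]
  have hoe : ∀ i, inner ℝ o (e i) = 1 := fun i => by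
    simp [o, e, EuclideanSpace.inner_single_right]
  have hmem : ∀ i, √(n / (n - 1)) • (e i - (n : ℝ)⁻¹ • o) ∈ (ℝ ∙ o)ᗮ := fun i => by
    rw [Submodule.mem_orthogonal_singleton_iff_inner_right, inner_smul_right, inner_sub_right,
      inner_smul_right, hoe, hoo, inv_mul_cancel₀ hn0.ne', sub_self, mul_zero]
  have hscale : ∀ x : EuclideanSpace ℝ (Fin n),
      ‖√(n / (n - 1) : ℝ) • x‖ ^ 2 = n / (n - 1) * ‖x‖ ^ 2 := fun x => by
    rw [norm_smul, mul_pow, Real.norm_eq_abs, sq_abs, Real.sq_sqrt (by positivity)]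
  have he : ∀ i, ‖e i - (n : ℝ)⁻¹ • o‖ ^ 2 = (n - 1) / n := fun i => by
    have hei : ‖e i‖ = 1 := by simp [e]
    rw [norm_sub_sq_real, inner_smul_right, real_inner_comm, hoe, hei, norm_smul, mul_pow,
      ← real_inner_self_eq_norm_sq o, hoo, Real.norm_eq_abs, sq_abs]
    field_simp
    ring
  have hee : ∀ i j, i ≠ j → ‖e i - e j‖ ^ 2 = 2 := fun i j hij => by
    rw [norm_sub_sq_real]
    norm_num [e, EuclideanSpace.inner_single_left, hij]
  refine ⟨fun i => ⟨_, hmem i⟩, fun i => ?_, fun i j hij => ?_⟩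
  · rw [Submodule.coe_norm, ← sq_eq_sq₀ (norm_nonneg _) zero_le_one, hscale, he]
    field_simp
  · rw [Submodule.coe_norm, Submodule.coe_sub, ← smul_sub, sub_sub_sub_cancel_right, hscale,
      hee i j hij, simplexSqDist]
    ring

lemma exists_simplex_of_le_finrank_add_one [FiniteDimensional ℝ E] {n : ℕ} (hn : 1 < n)
    (hE : n ≤ Module.finrank ℝ E + 1) :
    ∃ u : Fin n → E, (∀ i, ‖u i‖ = 1) ∧ ∀ i j, i ≠ j → ‖u i - u j‖ ^ 2 = simplexSqDist n := by
  obtain ⟨u, hu, hdist⟩ := exists_simplex_orthogonal_one hn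
  have hfact : Fact (Module.finrank ℝ (EuclideanSpace ℝ (Fin n)) = n - 1 + 1) :=
    ⟨by rw [finrank_euclideanSpace_fin]; omega⟩
  have hne : (WithLp.toLp 2 1 : EuclideanSpace ℝ (Fin n)) ≠ 0 := fun h =>
    one_ne_zero (congrFun (congrArg WithLp.ofLp h) ⟨0, by omega⟩)
  obtain ⟨T⟩ := exists_linearIsometry_of_finrank_le (E := (ℝ ∙ _)ᗮ) (F := E)
    ((Submodule.finrank_orthogonal_span_singleton (𝕜 := ℝ) (n := n - 1) hne).trans_le (by omega))
  exact ⟨T ∘ u, fun i => (T.norm_map _).trans (hu i), fun i j hij => by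
    rw [Function.comp_apply, Function.comp_apply, ← map_sub, T.norm_map, hdist i j hij]⟩

lemma isCenteredRegularSimplex_iff {d M : ℕ} (hM : 1 < M) {U : Fin M → UnitSphere d} :
    IsCenteredRegularSimplex U ↔ ∀ i j, i ≠ j →
      ‖(U i : EuclideanSpace ℝ (Fin d)) - U j‖ ^ 2 = simplexSqDist M := by
  have hcard : 1 < Fintype.card (Fin M) := by rwa [Fintype.card_fin]
  have hU : ∀ i, ‖(U i : EuclideanSpace ℝ (Fin d))‖ = 1 := fun i => norm_eq_of_mem_sphere (U i)
  refine ⟨fun ⟨_, ⟨r, hr⟩, hsum⟩ => ?_, fun h => ⟨?_, ⟨√(simplexSqDist M), fun i j hij => ?_⟩, ?_⟩⟩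
  · have hdist : ∀ i j, i ≠ j → ‖(U i : EuclideanSpace ℝ (Fin d)) - U j‖ ^ 2 = r ^ 2 :=
      fun i j hij => by rw [← dist_eq_norm, hr i j hij]
    have hr' := (sum_eq_zero_iff_sqDist_eq hcard hU hdist).1 hsum
    rw [Fintype.card_fin] at hr'
    rwa [← hr']
  · exact affineIndependent_of_sqDist_eq (simplexSqDist_mem_Ioc hM).1.ne' h
  · rw [dist_eq_norm, ← h i j hij, Real.sqrt_sq (norm_nonneg _)]
  · exact (sum_eq_zero_iff_sqDist_eq hcard hU h).2 (by rw [Fintype.card_fin])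

lemma exists_isCenteredRegularSimplex {d M : ℕ} (hM : 1 < M) (hMd : M ≤ d + 1) :
    ∃ U : Fin M → UnitSphere d, IsCenteredRegularSimplex U := by
  obtain ⟨u, hu, hdist⟩ := exists_simplex_of_le_finrank_add_one (E := EuclideanSpace ℝ (Fin d)) hM
    (by rwa [finrank_euclideanSpace_fin])
  exact ⟨fun i => ⟨u i, mem_sphere_zero_iff_norm.2 (hu i)⟩,
    (isCenteredRegularSimplex_iff hM).2 hdist⟩

end Simplex

section CrossPolytope

open scoped InnerProductSpace

variable {d M : ℕ} {U V : Fin M → UnitSphere d}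

lemma exists_isCrossPolytope (d : ℕ) : ∃ U : Fin (2 * d) → UnitSphere d, IsCrossPolytope U := by
  let e := EuclideanSpace.basisFun (Fin d) ℝ
  let σ : Fin d ⊕ Fin d ≃ Fin (2 * d) := finSumFinEquiv.trans (finCongr (two_mul d).symm)
  exact ⟨fun i => Sum.elim (fun k => ⟨e k, by simp [e]⟩) (fun k => ⟨-e k, by simp [e]⟩)
    (σ.symm i), e, σ, fun k => by simp⟩

namespace IsCrossPolytope

lemma card_eq (hU : IsCrossPolytope U) : M = 2 * d := by
  obtain ⟨-, σ, -⟩ := hU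
  simpa [two_mul] using (Fintype.card_congr σ).symm

lemma sum_eq_zero (hU : IsCrossPolytope U) : ∑ i, (U i : EuclideanSpace ℝ (Fin d)) = 0 := by
  obtain ⟨e, σ, h⟩ := hU
  rw [← σ.sum_comp, Fintype.sum_sum_type]
  simp only [h, Finset.sum_neg_distrib, add_neg_cancel]

lemma sum_inner_sq (hU : IsCrossPolytope U) (x : EuclideanSpace ℝ (Fin d)) :
    ∑ j, ⟪x, U j⟫_ℝ ^ 2 = 2 * ‖x‖ ^ 2 := by
  obtain ⟨e, σ, h⟩ := hU
  rw [← σ.sum_comp, Fintype.sum_sum_type]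
  simp only [h, inner_neg_right, neg_sq, e.sum_sq_inner_left, two_mul]

lemma finrank_mul_framePotential (hU : IsCrossPolytope U) :
    d * framePotential (fun i => (U i : EuclideanSpace ℝ (Fin d))) = (M : ℝ) ^ 2 := by
  simp only [framePotential, hU.sum_inner_sq, norm_eq_of_mem_sphere, Finset.sum_const,
    Finset.card_univ, Fintype.card_fin, nsmul_eq_mul, hU.card_eq]
  push_cast
  ring

lemma norm_sub_sq_eq (hU : IsCrossPolytope U) {i j : Fin M} (hij : i ≠ j) :
    ‖(U i : EuclideanSpace ℝ (Fin d)) - U j‖ ^ 2 = 2 ∨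
      ‖(U i : EuclideanSpace ℝ (Fin d)) - U j‖ ^ 2 = 4 := by
  rw [norm_sub_sq_of_norm_eq_one (norm_eq_of_mem_sphere _) (norm_eq_of_mem_sphere _)]
  obtain ⟨e, σ, h⟩ := hU
  obtain ⟨a, rfl⟩ := σ.surjective i
  obtain ⟨b, rfl⟩ := σ.surjective j
  rcases a with a | a <;> rcases b with b | b <;>
    simp only [h, inner_neg_left, inner_neg_right, e.inner_eq_ite] <;> split_ifs with hab <;>
    first | exact absurd (congrArg σ (congrArg _ hab)) hij | norm_num

end IsCrossPolytope

lemma framePotential_le_of_tight {ι E : Type*} [Fintype ι] [NormedAddCommGroup E]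
    [InnerProductSpace ℝ E] [FiniteDimensional ℝ E] {u v : ι → E} (hE : 0 < Module.finrank ℝ E)
    (hu : ∀ i, ‖u i‖ = 1)
    (hv : Module.finrank ℝ E * framePotential v = (Fintype.card ι : ℝ) ^ 2) :
    framePotential v ≤ framePotential u := by
  have h := sq_sum_norm_sq_le_finrank_mul_framePotential u
  simp only [hu, one_pow, Finset.sum_const, Finset.card_univ, nsmul_eq_mul, mul_one] at h
  exact le_of_mul_le_mul_left (hv.trans_le h) (Nat.cast_pos.2 hE)

lemma energy_quadratic_le {ι E : Type*} [Fintype ι] [NormedAddCommGroup E]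
    [InnerProductSpace ℝ E] {u v : ι → E} (hu : ∀ i, ‖u i‖ = 1) (hv : ∀ i, ‖v i‖ = 1)
    (hsum : ∑ i, v i = 0) (hframe : framePotential v ≤ framePotential u) (b : ℝ) {a c : ℝ}
    (ha : a ≤ 0) (hc : 0 ≤ c) :
    energy (fun t => b + a * (t - 2) + c * (t - 2) ^ 2) v ≤
      energy (fun t => b + a * (t - 2) + c * (t - 2) ^ 2) u := by
  rw [energy_quadratic hu, energy_quadratic hv, hsum, norm_zero]
  have h₁ : a * ‖∑ i, u i‖ ^ 2 ≤ 0 := mul_nonpos_of_nonpos_of_nonneg ha (sq_nonneg _)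
  have h₂ : c * framePotential v ≤ c * framePotential u := mul_le_mul_of_nonneg_left hframe hc
  linarith

lemma IsCrossPolytope.energy_le {φ : ℝ → ℝ} (hd : 1 ≤ d) (hV : IsCrossPolytope V)
    (hcont : ContinuousOn φ (Icc 0 4)) (hanti : AntitoneOn φ (Icc 0 4))
    (hconv : ConvexOn ℝ (Icc 0 4) φ) (hdiff : DifferentiableOn ℝ φ (Ioo 0 4))
    (hconc : ConcaveOn ℝ (Ioo 0 4) (deriv φ)) (U : Fin M → UnitSphere d) :
    energy φ (fun i => (V i : EuclideanSpace ℝ (Fin d))) ≤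
      energy φ (fun i => (U i : EuclideanSpace ℝ (Fin d))) := by
  obtain ⟨a, ha, c, hc, h4, hle⟩ :=
    exists_quadratic_minorant two_pos (by norm_num) hcont hanti hconv hdiff hconc
  have hunit : ∀ (W : Fin M → UnitSphere d) i, ‖(W i : EuclideanSpace ℝ (Fin d))‖ = 1 :=
    fun W i => norm_eq_of_mem_sphere (W i)
  have hframe : framePotential (fun i => (V i : EuclideanSpace ℝ (Fin d))) ≤
      framePotential (fun i => (U i : EuclideanSpace ℝ (Fin d))) :=
    framePotential_le_of_tight (by rwa [finrank_euclideanSpace_fin]) (hunit U)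
      (by rw [finrank_euclideanSpace_fin, Fintype.card_fin, hV.finrank_mul_framePotential])
  calc energy φ (fun i => (V i : EuclideanSpace ℝ (Fin d)))
    _ ≤ energy (fun t => φ 2 + a * (t - 2) + c * (t - 2) ^ 2)
        (fun i => (V i : EuclideanSpace ℝ (Fin d))) := energy_mono fun i j hij => by
      rcases hV.norm_sub_sq_eq hij with h | h <;> simp only [h]
      · linarith
      · exact h4.ge
    _ ≤ energy (fun t => φ 2 + a * (t - 2) + c * (t - 2) ^ 2)
        (fun i => (U i : EuclideanSpace ℝ (Fin d))) :=
      energy_quadratic_le (hunit U) (hunit V) hV.sum_eq_zero hframe (φ 2) ha hc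
    _ ≤ energy φ (fun i => (U i : EuclideanSpace ℝ (Fin d))) :=
      energy_mono fun i j _ => hle _ (norm_sub_sq_mem_Icc (hunit U i) (hunit U j))

end CrossPolytope

section Loss

variable {d M : ℕ} {γ : ℝ} {KA KU : UnitSphere d → UnitSphere d → ℝ}
  {U V W : Fin M → UnitSphere d}

lemma kcl_eq (KA KU : UnitSphere d → UnitSphere d → ℝ) (γ : ℝ) (U V : Fin M → UnitSphere d) :
    kcl KA KU γ U V = γ / (M * (M - 1)) * pairSum KU U - 1 / M * ∑ i, KA (U i) (V i) := by
  rw [kcl, sum_sum_erase_eq_pairSum]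
  ring

lemma kclSym_self (U : Fin M → UnitSphere d) : kclSym KA KU γ U U = kcl KA KU γ U U := by
  rw [kclSym]
  ring

lemma kcl_diag_le (hM : 1 < M) (hγ : 0 ≤ γ) (hA : ∀ x y z, KA x y ≤ KA z z)
    (hW : pairSum KU W ≤ pairSum KU U) : kcl KA KU γ W W ≤ kcl KA KU γ U V := by
  rw [kcl_eq, kcl_eq]
  exact sub_le_sub
    (mul_le_mul_of_nonneg_left hW (div_nonneg hγ (cast_mul_pred_pos hM).le))
    (mul_le_mul_of_nonneg_left (Finset.sum_le_sum fun i _ => hA _ _ _) (by positivity))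

lemma eq_of_kcl_le_diag (hM : 1 < M) (hγ : 0 < γ) (hA : ∀ x y z, KA x y ≤ KA z z)
    (hA' : ∀ x y, x ≠ y → KA x y < KA x x) (hW : pairSum KU W ≤ pairSum KU U)
    (h : kcl KA KU γ U V ≤ kcl KA KU γ W W) : U = V ∧ pairSum KU U ≤ pairSum KU W := by
  rw [kcl_eq, kcl_eq] at h
  have hcoeff : 0 < γ / ((M : ℝ) * (M - 1)) := div_pos hγ (cast_mul_pred_pos hM)
  have hM0 : 0 < 1 / (M : ℝ) := one_div_pos.2 (Nat.cast_pos.2 (zero_lt_one.trans hM))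
  have hunif := mul_le_mul_of_nonneg_left hW hcoeff.le
  have halign : ∑ i, KA (U i) (V i) ≤ ∑ i, KA (W i) (W i) :=
    Finset.sum_le_sum fun i _ => hA _ _ _
  refine ⟨?_, le_of_mul_le_mul_left
    (by linarith [mul_le_mul_of_nonneg_left halign hM0.le]) hcoeff⟩
  have hsum : ∑ i, KA (W i) (W i) ≤ ∑ i, KA (U i) (V i) :=
    le_of_mul_le_mul_left (by linarith) hM0
  by_contra hUV
  obtain ⟨i, hi⟩ := Function.ne_iff.1 hUV
  exact hsum.not_gt (Finset.sum_lt_sum (fun j _ => hA _ _ _)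
    ⟨i, Finset.mem_univ i, (hA' _ _ hi).trans_le (hA _ _ _)⟩)

lemma setOf_diag_subset_kclArgmin {P : (Fin M → UnitSphere d) → Prop} (hM : 1 < M) (hγ : 0 ≤ γ)
    (hA : ∀ x y z, KA x y ≤ KA z z)
    (hP : ∀ W, P W → ∀ U : Fin M → UnitSphere d, pairSum KU W ≤ pairSum KU U) :
    {p : (Fin M → UnitSphere d) × (Fin M → UnitSphere d) | p.1 = p.2 ∧ P p.1} ⊆
      kclArgmin KA KU γ := by
  rintro ⟨W, W'⟩ ⟨hWW', hPW : P W⟩ ⟨U, V⟩ -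
  obtain rfl : W = W' := hWW'
  change kclSym KA KU γ W W ≤ kclSym KA KU γ U V
  rw [kclSym_self, kclSym]
  linarith [kcl_diag_le (V := V) hM hγ hA (hP W hPW U),
    kcl_diag_le (V := U) hM hγ hA (hP W hPW V)]

lemma eq_of_mem_kclArgmin (hM : 1 < M) (hγ : 0 < γ) (hA : ∀ x y z, KA x y ≤ KA z z)
    (hA' : ∀ x y, x ≠ y → KA x y < KA x x)
    (hW : ∀ U : Fin M → UnitSphere d, pairSum KU W ≤ pairSum KU U)
    (hUV : (U, V) ∈ kclArgmin KA KU γ) : U = V ∧ pairSum KU U ≤ pairSum KU W := by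
  have hmin : kclSym KA KU γ U V ≤ kclSym KA KU γ W W := hUV (mem_univ (W, W))
  rw [kclSym_self, kclSym] at hmin
  exact eq_of_kcl_le_diag hM hγ hA hA' (hW U)
    (by linarith [kcl_diag_le (V := U) hM hγ.le hA (hW V)])

end Loss

section RadialKernel

variable {d M : ℕ} {κ : ℝ → ℝ} {l : ℝ}

lemma radialKernel_eq_update (κ : ℝ → ℝ) (l : ℝ) (x y : UnitSphere d) :
    radialKernel κ l x y =
      Function.update κ 0 l (‖(x : EuclideanSpace ℝ (Fin d)) - y‖ ^ 2) := by
  have hzero : ‖(x : EuclideanSpace ℝ (Fin d)) - y‖ ^ 2 = 0 ↔ x = y := by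
    rw [sq_eq_zero_iff, norm_eq_zero, sub_eq_zero, Subtype.coe_inj]
  simp only [radialKernel, Function.update_apply, hzero]

lemma pairSum_radialKernel (κ : ℝ → ℝ) (l : ℝ) (U : Fin M → UnitSphere d) :
    pairSum (radialKernel κ l) U =
      energy (Function.update κ 0 l) fun i => (U i : EuclideanSpace ℝ (Fin d)) :=
  Finset.sum_congr rfl fun _ _ => radialKernel_eq_update _ _ _ _

lemma radialKernel_self (κ : ℝ → ℝ) (l : ℝ) (x : UnitSphere d) : radialKernel κ l x x = l :=
  if_pos rfl

lemma radialKernel_le_self (hκ : AntitoneOn κ (Ioc 0 4)) (hl : Tendsto κ (𝓝[>] 0) (𝓝 l))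
    (x y z : UnitSphere d) : radialKernel κ l x y ≤ radialKernel κ l z z := by
  have hmem := norm_sub_sq_mem_Icc (norm_eq_of_mem_sphere x) (norm_eq_of_mem_sphere y)
  rw [radialKernel_self, radialKernel_eq_update]
  simpa only [Function.update_self] using
    antitoneOn_update_Icc hκ hl (left_mem_Icc.2 zero_le_four) hmem hmem.1

lemma radialKernel_lt_self (hκ : StrictAntiOn κ (Ioc 0 4)) (hl : Tendsto κ (𝓝[>] 0) (𝓝 l))
    {x y : UnitSphere d} (hxy : x ≠ y) : radialKernel κ l x y < radialKernel κ l x x := by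
  have hmem := norm_sub_sq_mem_Icc (norm_eq_of_mem_sphere x) (norm_eq_of_mem_sphere y)
  have hpos : 0 < ‖(x : EuclideanSpace ℝ (Fin d)) - y‖ ^ 2 :=
    pow_pos (norm_pos_iff.2 (sub_ne_zero.2 (Subtype.coe_injective.ne hxy))) 2
  rw [radialKernel_self, radialKernel_eq_update]
  simpa only [Function.update_self] using
    strictAntiOn_update_Icc hκ hl (left_mem_Icc.2 zero_le_four) hmem hpos

end RadialKernel

section RadialPairSums

variable {d M : ℕ} {κ : ℝ → ℝ} {l : ℝ} {U V : Fin M → UnitSphere d}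

lemma IsCenteredRegularSimplex.energy_eq (hM : 1 < M) (hU : IsCenteredRegularSimplex U)
    (φ : ℝ → ℝ) :
    energy φ (fun i => (U i : EuclideanSpace ℝ (Fin d))) = M * (M - 1) * φ (simplexSqDist M) := by
  rw [energy_eq_of_sqDist_eq ((isCenteredRegularSimplex_iff hM).1 hU), Fintype.card_fin]

lemma IsCenteredRegularSimplex.pairSum_le (hM : 1 < M) (hU : IsCenteredRegularSimplex U)
    (hl : Tendsto κ (𝓝[>] 0) (𝓝 l)) (hanti : AntitoneOn κ (Ioc 0 4))
    (hconv : ConvexOn ℝ (Ioc 0 4) κ) (V : Fin M → UnitSphere d) :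
    pairSum (radialKernel κ l) U ≤ pairSum (radialKernel κ l) V := by
  rw [pairSum_radialKernel, pairSum_radialKernel, hU.energy_eq hM]
  simpa only [Fintype.card_fin] using
    simplex_energy_le_energy (u := fun i => (V i : EuclideanSpace ℝ (Fin d)))
      (by rwa [Fintype.card_fin]) (fun i => norm_eq_of_mem_sphere (V i))
      (antitoneOn_update_Icc hanti hl) (convexOn_update_Icc hconv hl)

lemma IsCenteredRegularSimplex.of_pairSum_le (hM : 1 < M) (hU : IsCenteredRegularSimplex U)
    (hl : Tendsto κ (𝓝[>] 0) (𝓝 l)) (hanti : StrictAntiOn κ (Ioc 0 4))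
    (hconv : StrictConvexOn ℝ (Ioc 0 4) κ)
    (hVU : pairSum (radialKernel κ l) V ≤ pairSum (radialKernel κ l) U) :
    IsCenteredRegularSimplex V := by
  rw [pairSum_radialKernel, pairSum_radialKernel, hU.energy_eq hM] at hVU
  refine (isCenteredRegularSimplex_iff hM).2 fun i j hij => ?_
  simpa only [Fintype.card_fin] using
    sqDist_eq_of_energy_le_simplex_energy (u := fun i => (V i : EuclideanSpace ℝ (Fin d)))
      (by rwa [Fintype.card_fin]) (fun i => norm_eq_of_mem_sphere (V i))
      (strictAntiOn_update_Icc hanti hl) (strictConvexOn_update_Icc hconv hl)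
      (by rwa [Fintype.card_fin]) hij

lemma IsCrossPolytope.pairSum_le (hd : 1 ≤ d) (hU : IsCrossPolytope U)
    (hl : Tendsto κ (𝓝[>] 0) (𝓝 l)) (hcont : ContinuousOn κ (Ioc 0 4))
    (hanti : AntitoneOn κ (Ioc 0 4)) (hconv : ConvexOn ℝ (Ioc 0 4) κ)
    (hdiff : DifferentiableOn ℝ κ (Ioo 0 4)) (hconc : ConcaveOn ℝ (Ioo 0 4) (deriv κ))
    (V : Fin M → UnitSphere d) :
    pairSum (radialKernel κ l) U ≤ pairSum (radialKernel κ l) V := by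
  have heq : EqOn (Function.update κ 0 l) κ (Ioo 0 4) := fun x hx =>
    Function.update_of_ne hx.1.ne' l κ
  rw [pairSum_radialKernel, pairSum_radialKernel]
  exact hU.energy_le hd (continuousOn_update_Icc hcont hl) (antitoneOn_update_Icc hanti hl)
    (convexOn_update_Icc hconv hl) (hdiff.congr heq)
    (hconc.congr (heq.symm.deriv isOpen_Ioo)) V

end RadialPairSums

namespace CompletelyMonotoneOn

variable {f : ℝ → ℝ} {a b : ℝ}

lemma hasDerivAt_iteratedDerivWithin (hf : CompletelyMonotoneOn f (Ioc a b)) (n : ℕ) {x : ℝ}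
    (hx : x ∈ Ioo a b) : HasDerivAt (iteratedDerivWithin n f (Ioc a b))
      (iteratedDerivWithin (n + 1) f (Ioc a b) x) x := by
  rw [iteratedDerivWithin_succ]
  exact (hf.1.differentiableOn_iteratedDerivWithin (m := n)
    (by exact_mod_cast WithTop.coe_lt_top n) (uniqueDiffOn_Ioc a b) x
    (Ioo_subset_Ioc_self hx)).hasDerivWithinAt.hasDerivAt (Ioc_mem_nhds hx.1 hx.2)

lemma hasDerivAt (hf : CompletelyMonotoneOn f (Ioc a b)) {x : ℝ} (hx : x ∈ Ioo a b) :
    HasDerivAt f (iteratedDerivWithin 1 f (Ioc a b) x) x := by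
  simpa only [iteratedDerivWithin_zero] using hf.hasDerivAt_iteratedDerivWithin 0 hx

lemma antitoneOn (hf : CompletelyMonotoneOn f (Ioc a b)) : AntitoneOn f (Ioc a b) := by
  refine antitoneOn_of_hasDerivWithinAt_nonpos (f' := iteratedDerivWithin 1 f (Ioc a b))
    (convex_Ioc a b) hf.1.continuousOn ?_ ?_ <;> rw [interior_Ioc] <;> intro x hx
  · exact (hf.hasDerivAt hx).hasDerivWithinAt
  · simpa using hf.2 1 x (Ioo_subset_Ioc_self hx)

lemma convexOn (hf : CompletelyMonotoneOn f (Ioc a b)) : ConvexOn ℝ (Ioc a b) f := by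
  refine convexOn_of_hasDerivWithinAt2_nonneg (f' := iteratedDerivWithin 1 f (Ioc a b))
    (f'' := iteratedDerivWithin 2 f (Ioc a b))
    (convex_Ioc a b) hf.1.continuousOn ?_ ?_ ?_ <;> rw [interior_Ioc] <;> intro x hx
  · exact (hf.hasDerivAt hx).hasDerivWithinAt
  · exact (hf.hasDerivAt_iteratedDerivWithin 1 hx).hasDerivWithinAt
  · simpa using hf.2 2 x (Ioo_subset_Ioc_self hx)

lemma differentiableOn (hf : CompletelyMonotoneOn f (Ioc a b)) :
    DifferentiableOn ℝ f (Ioo a b) := fun _ hx =>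
  (hf.hasDerivAt hx).differentiableAt.differentiableWithinAt

lemma concaveOn_deriv (hf : CompletelyMonotoneOn f (Ioc a b)) :
    ConcaveOn ℝ (Ioo a b) (deriv f) := by
  have hderiv := fun n x (hx : x ∈ Ioo a b) => hf.hasDerivAt_iteratedDerivWithin n hx
  refine ConcaveOn.congr (f := iteratedDerivWithin 1 f (Ioc a b)) ?_
    fun x hx => (hf.hasDerivAt hx).deriv.symm
  refine concaveOn_of_hasDerivWithinAt2_nonpos (f' := iteratedDerivWithin 2 f (Ioc a b))
    (f'' := iteratedDerivWithin 3 f (Ioc a b)) (convex_Ioo a b)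
    (fun x hx => (hderiv 1 x hx).continuousAt.continuousWithinAt) ?_ ?_ ?_ <;>
    rw [interior_Ioo] <;> intro x hx
  · exact (hderiv 1 x hx).hasDerivWithinAt
  · exact (hderiv 2 x hx).hasDerivWithinAt
  · linarith [hf.2 3 x (Ioo_subset_Ioc_self hx)]

end CompletelyMonotoneOn

end KCL

theorem theorem3_general (d M : ℕ) (hd : 1 ≤ d) (γ : ℝ) (hγ : 0 < γ)
    (KA : KCL.UnitSphere d → KCL.UnitSphere d → ℝ) (κU : ℝ → ℝ) (lU : ℝ)
    (hlU : Tendsto κU (𝓝[>] 0) (𝓝 lU)) :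
    (1 < M → M ≤ d + 1 →
      (∃ U : Fin M → KCL.UnitSphere d, KCL.IsCenteredRegularSimplex U) ∧
      ((∀ x y z, KA x y ≤ KA z z) → AntitoneOn κU (Ioc 0 4) → ConvexOn ℝ (Ioc 0 4) κU →
        {p : (Fin M → KCL.UnitSphere d) × (Fin M → KCL.UnitSphere d) |
            p.1 = p.2 ∧ KCL.IsCenteredRegularSimplex p.1} ⊆
          KCL.kclArgmin KA (KCL.radialKernel κU lU) γ) ∧
      ((∀ x y z, KA x y ≤ KA z z) → (∀ x y, x ≠ y → KA x y < KA x x) →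
        StrictAntiOn κU (Ioc 0 4) → StrictConvexOn ℝ (Ioc 0 4) κU →
        KCL.kclArgmin KA (KCL.radialKernel κU lU) γ =
          {p : (Fin M → KCL.UnitSphere d) × (Fin M → KCL.UnitSphere d) |
            p.1 = p.2 ∧ KCL.IsCenteredRegularSimplex p.1})) ∧
    (M = 2 * d →
      (∃ U : Fin M → KCL.UnitSphere d, KCL.IsCrossPolytope U) ∧
      ((∀ x y z, KA x y ≤ KA z z) → AntitoneOn κU (Ioc 0 4) → ConvexOn ℝ (Ioc 0 4) κU →
        ContinuousOn κU (Ioc 0 4) → DifferentiableOn ℝ κU (Ioo 0 4) →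
        ConcaveOn ℝ (Ioo 0 4) (deriv κU) →
        {p : (Fin M → KCL.UnitSphere d) × (Fin M → KCL.UnitSphere d) |
            p.1 = p.2 ∧ KCL.IsCrossPolytope p.1} ⊆
          KCL.kclArgmin KA (KCL.radialKernel κU lU) γ)) := by
  refine ⟨fun hM hMd => ?_, ?_⟩
  · obtain ⟨W, hW⟩ := KCL.exists_isCenteredRegularSimplex hM hMd
    refine ⟨⟨W, hW⟩, fun hA hanti hconv => ?_, fun hA hA' hanti hconv => Subset.antisymm ?_ ?_⟩
    · exact KCL.setOf_diag_subset_kclArgmin hM hγ.le hA fun U hU =>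
        hU.pairSum_le hM hlU hanti hconv
    · rintro ⟨U, V⟩ hUV
      exact (KCL.eq_of_mem_kclArgmin hM hγ hA hA'
        (hW.pairSum_le hM hlU hanti.antitoneOn hconv.convexOn) hUV).imp_right
          (hW.of_pairSum_le hM hlU hanti hconv)
    · exact KCL.setOf_diag_subset_kclArgmin hM hγ.le hA fun U hU =>
        hU.pairSum_le hM hlU hanti.antitoneOn hconv.convexOn
  · rintro rfl
    exact ⟨KCL.exists_isCrossPolytope d, fun hA hanti hconv hcont hdiff hconc =>
      KCL.setOf_diag_subset_kclArgmin (by omega) hγ.le hA fun U hU =>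
        hU.pairSum_le hd hlU hcont hanti hconv hdiff hconc⟩

theorem theorem3 (d M : ℕ) (hd : 1 ≤ d) (γ : ℝ) (hγ : 0 < γ)
    (κA κU : ℝ → ℝ) (lA lU : ℝ)
    (hlA : Tendsto κA (𝓝[>] 0) (𝓝 lA)) (hlU : Tendsto κU (𝓝[>] 0) (𝓝 lU)) :
    (1 < M → M ≤ d + 1 →
      (∃ U : Fin M → KCL.UnitSphere d, KCL.IsCenteredRegularSimplex U) ∧
      (AntitoneOn κA (Ioc 0 4) → AntitoneOn κU (Ioc 0 4) → ConvexOn ℝ (Ioc 0 4) κU →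
        {p : (Fin M → KCL.UnitSphere d) × (Fin M → KCL.UnitSphere d) |
            p.1 = p.2 ∧ KCL.IsCenteredRegularSimplex p.1} ⊆
          KCL.kclArgmin (KCL.radialKernel κA lA) (KCL.radialKernel κU lU) γ) ∧
      (StrictAntiOn κA (Ioc 0 4) → StrictAntiOn κU (Ioc 0 4) →
        StrictConvexOn ℝ (Ioc 0 4) κU →
        KCL.kclArgmin (KCL.radialKernel κA lA) (KCL.radialKernel κU lU) γ =
          {p : (Fin M → KCL.UnitSphere d) × (Fin M → KCL.UnitSphere d) |
            p.1 = p.2 ∧ KCL.IsCenteredRegularSimplex p.1})) ∧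
    (M = 2 * d →
      (∃ U : Fin M → KCL.UnitSphere d, KCL.IsCrossPolytope U) ∧
      (AntitoneOn κA (Ioc 0 4) → KCL.CompletelyMonotoneOn κU (Ioc 0 4) →
        {p : (Fin M → KCL.UnitSphere d) × (Fin M → KCL.UnitSphere d) |
            p.1 = p.2 ∧ KCL.IsCrossPolytope p.1} ⊆
          KCL.kclArgmin (KCL.radialKernel κA lA) (KCL.radialKernel κU lU) γ)) :=
  (theorem3_general d M hd γ hγ (KCL.radialKernel κA lA) κU lU hlU).imp
    (fun h hM hMd => (h hM hMd).imp_right (And.imp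
      (fun h hA => h (KCL.radialKernel_le_self hA hlA))
      fun h hA => h (KCL.radialKernel_le_self hA.antitoneOn hlA)
        fun _ _ => KCL.radialKernel_lt_self hA hlA))
    fun h hM => (h hM).imp_right fun h hA hU => h (KCL.radialKernel_le_self hA hlA)
      hU.antitoneOn hU.convexOn hU.1.continuousOn hU.differentiableOn hU.concaveOn_deriv
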